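/- Let $V\in C^2(\mathbb R^n,\mathbb R)$ and write $V'(q)q=(\nabla V(q),q)$ and $(V''(q)q,q)$ for the Hessian form of $V$ at $q$ evaluated at $(q,q)$. Assume that (1) $V(-q)=V(q)$ for all $q$; (2) $V'(q)q>0$ for all $q\neq0$; (3) $3V'(q)q+(V''(q)q,q)\neq0$ for all $q\neq0$; (4) there are constants $\mu_1>0$ and $\mu_2\ge0$ with $V'(q)q\ge\mu_1V(q)-\mu_2$ for all $q$. Put $$A=\limsup_{|q|\to\infty}\left[V(q)+\tfrac12V'(q)q\right],$$ where the value $A=+\infty$ is allowed. Then for every $h\in\mathbb R$ with $\mu_2/\mu_1<h<A$, the system $$\ddot q+V'(q)=0,\qquad \tfrac12|\dot q|^2+V(q)=h$$ has at least one non-constant periodic solution $q\in C^2(\mathbb R,\mathbb R^n)$, where $V'(q)$ in the first equation denotes the gradient $\nabla V(q)$. -/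

import Mathlib

open Filter

/-- `q : ℝ → ℝⁿ` is a classical (`C²`) solution, on the whole time axis, of
`q'' + V'(q) = 0` with energy `|q'|² / 2 + V(q) = h` at every time. -/
structure IsSolutionWithEnergy {n : ℕ} (V : EuclideanSpace ℝ (Fin n) → ℝ) (h : ℝ)
    (q : ℝ → EuclideanSpace ℝ (Fin n)) : Prop where
  contDiff : ContDiff ℝ 2 q
  newton : ∀ t : ℝ, deriv (deriv q) t + gradient V (q t) = 0
  energy : ∀ t : ℝ, (1 / 2 : ℝ) * ‖deriv q t‖ ^ 2 + V (q t) = h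

/-- The quantity `V(q) + V'(q)q / 2`. -/
noncomputable def virialEnergy {n : ℕ} (V : EuclideanSpace ℝ (Fin n) → ℝ)
    (q : EuclideanSpace ℝ (Fin n)) : ℝ :=
  V q + (1 / 2 : ℝ) * fderiv ℝ V q q

/-! Critical points of `½ ∫ |q'|² ∫ (h - V(q))` on paths with `q(1) = -q(0)` are, after a change of
time, solutions of energy `h`. Writing `q` as the primitive of `u = q'` turns this into a problem on
`L²(0,1)`. The functional is minimized on the Nehari-type set where its derivative along rays
vanishes, that is, where `V + ½ V'(q)q` has mean `h`.

(3) makes `V + ½ V'(q)q` strictly increasing along rays (`strictMonoOn_virialEnergy_ray`). Hence on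
the constraint the functional is maximal along its ray (`sq_mul_potentialGap_smul_le`), and
perturbations can be scaled back to the constraint (`eventually_exists_smul_virialMean_eq`). `h < A`
makes the constraint nonempty (`exists_virialMean_eq`). (4) keeps `∫ (h - V)` away from zero there
(`potentialGap_lower_bound`), so minimizing sequences are bounded and a weak limit is a minimizer
(`exists_minimizer`).

Being maximal along rays, the constraint produces no multiplier: the minimizer is a free critical
point (`euler_lagrange`). Evenness of `V` makes the force odd, so the critical path extends
antiperiodically to a smooth solution on the line (`exists_antiperiodic_solution`). Rescaling time
gives energy `h` (`exists_periodic_solution_of_critical`). -/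

open Set MeasureTheory Topology intervalIntegral

/-! ### Monotonicity along rays -/

section Ray

variable {n : ℕ} {V : EuclideanSpace ℝ (Fin n) → ℝ}

theorem continuous_virialEnergy (hV : ContDiff ℝ 2 V) : Continuous (virialEnergy V) := by
  have h1 : Continuous (fderiv ℝ V) := hV.continuous_fderiv (by norm_num)
  unfold virialEnergy
  exact hV.continuous.add (continuous_const.mul (h1.clm_apply continuous_id))

theorem virialEnergy_zero : virialEnergy V 0 = V 0 := by
  simp [virialEnergy]

theorem hasDerivAt_ray (hV : ContDiff ℝ 2 V) (q : EuclideanSpace ℝ (Fin n)) (s : ℝ) :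
    HasDerivAt (fun s : ℝ => V (s • q)) (fderiv ℝ V (s • q) q) s := by
  have h1 : HasFDerivAt V (fderiv ℝ V (s • q)) (s • q) :=
    ((hV.differentiable (by norm_num)) _).hasFDerivAt
  have h2 : HasDerivAt (fun s : ℝ => s • q) q s := by
    simpa using (hasDerivAt_id s).smul_const q
  exact h1.comp_hasDerivAt s h2

theorem hasDerivAt_fderiv_ray (hV : ContDiff ℝ 2 V) (q : EuclideanSpace ℝ (Fin n)) (s : ℝ) :
    HasDerivAt (fun s : ℝ => fderiv ℝ V (s • q) q) (fderiv ℝ (fderiv ℝ V) (s • q) q q) s := by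
  have h0 : ContDiff ℝ 1 (fderiv ℝ V) := hV.fderiv_right (by norm_num)
  have h1 : HasFDerivAt (fderiv ℝ V) (fderiv ℝ (fderiv ℝ V) (s • q)) (s • q) :=
    ((h0.differentiable (by norm_num)) _).hasFDerivAt
  have h2 : HasDerivAt (fun s : ℝ => s • q) q s := by
    simpa using (hasDerivAt_id s).smul_const q
  have h3 := h1.comp_hasDerivAt s h2
  simpa using h3.clm_apply (hasDerivAt_const s q)

/-- The nondegeneracy condition has a sign: it says that `s³ V'(sq)q` increases in `s`. -/
theorem three_mul_fderiv_add_hessian_pos (hV : ContDiff ℝ 2 V)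
    (V2 : ∀ q, q ≠ 0 → 0 < fderiv ℝ V q q)
    (V3 : ∀ q, q ≠ 0 → 3 * fderiv ℝ V q q + fderiv ℝ (fderiv ℝ V) q q q ≠ 0)
    {q : EuclideanSpace ℝ (Fin n)} (hq : q ≠ 0) :
    0 < 3 * fderiv ℝ V q q + fderiv ℝ (fderiv ℝ V) q q q := by
  have h0 : ContDiff ℝ 1 (fderiv ℝ V) := hV.fderiv_right (by norm_num)
  set N : ℝ → ℝ := fun s => 3 * fderiv ℝ V (s • q) (s • q)
    + fderiv ℝ (fderiv ℝ V) (s • q) (s • q) (s • q) with hN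
  have hNc : Continuous N := by
    have h1 : Continuous (fderiv ℝ V) := h0.continuous
    have h2 : Continuous (fderiv ℝ (fderiv ℝ V)) := h0.continuous_fderiv (by norm_num)
    have h3 : Continuous fun s : ℝ => s • q := by fun_prop
    exact (continuous_const.mul ((h1.comp h3).clm_apply h3)).add
      (((h2.comp h3).clm_apply h3).clm_apply h3)
  have hd : ∀ s : ℝ, HasDerivAt (fun s : ℝ => s ^ 3 * fderiv ℝ V (s • q) q) (s * N s) s := by
    intro s
    have := (hasDerivAt_pow 3 s).mul (hasDerivAt_fderiv_ray hV q s)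
    refine this.congr_deriv ?_
    simp only [hN, map_smul, _root_.smul_apply, smul_eq_mul]
    push_cast
    ring
  -- `s³ V'(sq)q` rises from zero to a positive value, so `N` is positive somewhere in `(0, 1)`; if
  -- it were nonpositive at `1`, it would vanish in between, at a nonzero point of the ray.
  obtain ⟨s, ⟨hs0, hs1⟩, hs⟩ := exists_hasDerivAt_eq_slope
    (fun s : ℝ => s ^ 3 * fderiv ℝ V (s • q) q) (fun s => s * N s) zero_lt_one
    (fun s _ => (hd s).continuousAt.continuousWithinAt) (fun s _ => hd s)
  have hpos : 0 < s * N s := by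
    rw [hs]
    simpa using V2 q hq
  have hNs : 0 < N s := pos_of_mul_pos_right hpos hs0.le
  by_contra hcon
  have hN1 : N 1 ≤ 0 := by
    simpa [hN] using hcon
  obtain ⟨r, ⟨hr0, -⟩, hr⟩ := intermediate_value_Icc' hs1.le hNc.continuousOn
    ⟨hN1, hNs.le⟩
  exact V3 (r • q) (smul_ne_zero (hs0.trans_le hr0).ne' hq) hr

/-- With `x = sq`, the `s`-derivative times `2s` is `3 V'(x)x + (V''(x)x, x)`. -/
theorem strictMonoOn_virialEnergy_ray (hV : ContDiff ℝ 2 V)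
    (V2 : ∀ q, q ≠ 0 → 0 < fderiv ℝ V q q)
    (V3 : ∀ q, q ≠ 0 → 3 * fderiv ℝ V q q + fderiv ℝ (fderiv ℝ V) q q q ≠ 0)
    {q : EuclideanSpace ℝ (Fin n)} (hq : q ≠ 0) :
    StrictMonoOn (fun s : ℝ => virialEnergy V (s • q)) (Ici 0) := by
  have hd : ∀ s : ℝ, HasDerivAt (fun s : ℝ => virialEnergy V (s • q))
      (fderiv ℝ V (s • q) q + (1 / 2 : ℝ) * (1 * fderiv ℝ V (s • q) q
        + s * fderiv ℝ (fderiv ℝ V) (s • q) q q)) s := by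
    intro s
    have h1 := (hasDerivAt_ray hV q s).add
      (((hasDerivAt_id s).mul (hasDerivAt_fderiv_ray hV q s)).const_mul (1 / 2 : ℝ))
    refine (h1.congr_deriv ?_).congr_of_eventuallyEq (Eventually.of_forall fun r => ?_)
    · simp
    · simp [virialEnergy]
  refine strictMonoOn_of_deriv_pos (convex_Ici 0)
    (fun s _ => (hd s).continuousAt.continuousWithinAt) fun s hs => ?_
  rw [interior_Ici, mem_Ioi] at hs
  rw [(hd s).deriv]
  have h1 := three_mul_fderiv_add_hessian_pos hV V2 V3 (smul_ne_zero hs.ne' hq)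
  simp only [map_smul, _root_.smul_apply, smul_eq_mul] at h1
  have h2 : 0 < s * (2 * (fderiv ℝ V (s • q) q + (1 / 2 : ℝ) * (1 * fderiv ℝ V (s • q) q
        + s * fderiv ℝ (fderiv ℝ V) (s • q) q q))) := by linarith
  have h3 := pos_of_mul_pos_right h2 hs.le
  linarith

theorem monotoneOn_virialEnergy_ray (hV : ContDiff ℝ 2 V)
    (V2 : ∀ q, q ≠ 0 → 0 < fderiv ℝ V q q)
    (V3 : ∀ q, q ≠ 0 → 3 * fderiv ℝ V q q + fderiv ℝ (fderiv ℝ V) q q q ≠ 0)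
    (q : EuclideanSpace ℝ (Fin n)) :
    MonotoneOn (fun s : ℝ => virialEnergy V (s • q)) (Ici 0) := by
  rcases eq_or_ne q 0 with rfl | hq
  · simpa using monotoneOn_const
  · exact (strictMonoOn_virialEnergy_ray hV V2 V3 hq).monotoneOn

/-- The difference `s² (V(sq) - G(q))`, with `G` the virial energy, has derivative `2s (G(sq) -
G(q))`, so it is least at `s = 1`. -/
theorem sq_sub_one_mul_virialEnergy_le (hV : ContDiff ℝ 2 V)
    (V2 : ∀ q, q ≠ 0 → 0 < fderiv ℝ V q q)
    (V3 : ∀ q, q ≠ 0 → 3 * fderiv ℝ V q q + fderiv ℝ (fderiv ℝ V) q q q ≠ 0)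
    (q : EuclideanSpace ℝ (Fin n)) {s : ℝ} (hs : 0 ≤ s) :
    (s ^ 2 - 1) * virialEnergy V q ≤ s ^ 2 * V (s • q) - V q := by
  have hmono := monotoneOn_virialEnergy_ray hV V2 V3 q
  set m : ℝ → ℝ := fun s => s ^ 2 * V (s • q) - s ^ 2 * virialEnergy V q with hm
  have hd : ∀ s : ℝ, HasDerivAt m
      (2 * s * (virialEnergy V (s • q) - virialEnergy V q)) s := by
    intro s
    have h1 := ((hasDerivAt_pow 2 s).mul (hasDerivAt_ray hV q s)).sub
      ((hasDerivAt_pow 2 s).mul_const (virialEnergy V q))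
    refine h1.congr_deriv ?_
    simp only [virialEnergy, map_smul, smul_eq_mul]
    push_cast
    ring
  have hc : Continuous m := continuous_iff_continuousAt.2 fun s => (hd s).continuousAt
  have key : m 1 ≤ m s := by
    rcases le_total s 1 with h1 | h1
    · refine antitoneOn_of_deriv_nonpos (convex_Icc 0 1) hc.continuousOn
        (fun x _ => (hd x).differentiableAt.differentiableWithinAt) (fun x hx => ?_)
        ⟨hs, h1⟩ ⟨zero_le_one, le_rfl⟩ h1
      rw [interior_Icc] at hx
      rw [(hd x).deriv]
      have := hmono (mem_Ici.2 hx.1.le) (mem_Ici.2 zero_le_one) hx.2.le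
      simp only [one_smul] at this
      exact mul_nonpos_of_nonneg_of_nonpos (by linarith [hx.1]) (by linarith)
    · refine monotoneOn_of_deriv_nonneg (convex_Ici 1) hc.continuousOn
        (fun x _ => (hd x).differentiableAt.differentiableWithinAt) (fun x hx => ?_)
        (mem_Ici.2 le_rfl) (mem_Ici.2 h1) h1
      rw [interior_Ici, mem_Ioi] at hx
      rw [(hd x).deriv]
      have := hmono (mem_Ici.2 zero_le_one) (mem_Ici.2 (by linarith : (0:ℝ) ≤ x)) hx.le
      simp only [one_smul] at this
      exact mul_nonneg (by linarith) (by linarith)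
  simp only [hm, one_smul] at key
  linarith

end Ray

/-! ### Primitives with opposite end values, as operators on `L²` -/

section AntiPrimitive

/-- Lebesgue measure on the unit interval. -/
noncomputable abbrev unitMeasure : Measure ℝ := volume.restrict (Ioc 0 1)

instance : IsProbabilityMeasure unitMeasure := ⟨by simp⟩

variable {E : Type*} [NormedAddCommGroup E]

theorem integral_norm_le_norm_Lp_two (u : Lp E 2 unitMeasure) :
    ∫ x, ‖u x‖ ∂unitMeasure ≤ ‖u‖ := by
  have hu := Lp.memLp u
  rw [integral_norm_eq_lintegral_enorm hu.1, Lp.norm_def, ← eLpNorm_one_eq_lintegral_enorm]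
  exact ENNReal.toReal_mono hu.2.ne (eLpNorm_le_eLpNorm_of_exponent_le (by norm_num) hu.1)

theorem integrable_Lp_two (u : Lp E 2 unitMeasure) : Integrable u unitMeasure :=
  (Lp.memLp u).integrable (by norm_num)

theorem integrable_unitMeasure_of_continuous {f : ℝ → E}
    (hf : Continuous f) : Integrable f unitMeasure :=
  (hf.integrableOn_Icc (a := 0) (b := 1)).mono_set Ioc_subset_Icc_self

theorem tendsto_integral_comp [ProperSpace E] {ι : Type*} {l : Filter ι}
    [l.IsCountablyGenerated] {F : E → ℝ} (hF : Continuous F) {x : ι → ℝ → E} {y : ℝ → E}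
    (hx : ∀ i, Continuous (x i)) {R : ℝ} (hR : ∀ᶠ i in l, ∀ t, ‖x i t‖ ≤ R)
    (hxy : ∀ᵐ t ∂unitMeasure, Tendsto (fun i => x i t) l (𝓝 (y t))) :
    Tendsto (fun i => ∫ t, F (x i t) ∂unitMeasure) l (𝓝 (∫ t, F (y t) ∂unitMeasure)) := by
  obtain ⟨C, hC⟩ := (isCompact_closedBall (0 : E) R).exists_bound_of_continuousOn hF.continuousOn
  refine tendsto_integral_filter_of_dominated_convergence (fun _ => C)
    (Eventually.of_forall fun i => (hF.comp (hx i)).aestronglyMeasurable) ?_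
    (integrable_const _) ?_
  · filter_upwards [hR] with i hi
    exact Eventually.of_forall fun t => hC _ (mem_closedBall_zero_iff.2 (hi t))
  · filter_upwards [hxy] with t ht
    exact (hF.tendsto _).comp ht

variable [NormedSpace ℝ E]

/-- The primitive of `f` on the unit interval that takes opposite values at `0` and `1`. -/
noncomputable def antiPrimitive (f : ℝ → E) (t : ℝ) : E :=
  (∫ x in (0 : ℝ)..t, f x ∂unitMeasure) - (1 / 2 : ℝ) • ∫ x, f x ∂unitMeasure

theorem continuous_antiPrimitive {f : ℝ → E} (hf : Integrable f unitMeasure) :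
    Continuous (antiPrimitive f) :=
  (continuous_primitive (fun _ _ => hf.intervalIntegrable) 0).sub continuous_const

theorem norm_antiPrimitive_le {f : ℝ → E} (hf : Integrable f unitMeasure) (t : ℝ) :
    ‖antiPrimitive f t‖ ≤ 2 * ∫ x, ‖f x‖ ∂unitMeasure := by
  have h1 : ‖∫ x in (0 : ℝ)..t, f x ∂unitMeasure‖ ≤ ∫ x, ‖f x‖ ∂unitMeasure :=
    (norm_integral_le_integral_norm_uIoc).trans
      (setIntegral_le_integral hf.norm (Eventually.of_forall fun _ => norm_nonneg _))
  have h2 : ‖∫ x, f x ∂unitMeasure‖ ≤ ∫ x, ‖f x‖ ∂unitMeasure :=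
    norm_integral_le_integral_norm _
  have h3 : ‖(1 / 2 : ℝ) • ∫ x, f x ∂unitMeasure‖ ≤ (1 / 2) * ∫ x, ‖f x‖ ∂unitMeasure := by
    rw [norm_smul]
    norm_num
    linarith
  have h4 : 0 ≤ ∫ x, ‖f x‖ ∂unitMeasure := integral_nonneg fun _ => norm_nonneg _
  unfold antiPrimitive
  linarith [norm_sub_le (∫ x in (0 : ℝ)..t, f x ∂unitMeasure)
    ((1 / 2 : ℝ) • ∫ x, f x ∂unitMeasure)]

theorem antiPrimitive_congr_ae {f g : ℝ → E} (h : f =ᵐ[unitMeasure] g) :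
    antiPrimitive f = antiPrimitive g := by
  ext t
  unfold antiPrimitive
  rw [integral_congr_ae h, integral_congr_ae_restrict (ae_restrict_of_ae h)]

theorem antiPrimitive_add {f g : ℝ → E} (hf : Integrable f unitMeasure)
    (hg : Integrable g unitMeasure) (t : ℝ) :
    antiPrimitive (fun x => f x + g x) t = antiPrimitive f t + antiPrimitive g t := by
  unfold antiPrimitive
  rw [MeasureTheory.integral_add hf hg,
    intervalIntegral.integral_add hf.intervalIntegrable hg.intervalIntegrable]
  module

theorem antiPrimitive_smul (c : ℝ) (f : ℝ → E) (t : ℝ) :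
    antiPrimitive (fun x => c • f x) t = c • antiPrimitive f t := by
  unfold antiPrimitive
  rw [MeasureTheory.integral_smul, intervalIntegral.integral_smul]
  module

/-- The restricted measure makes the primitive depend only on the class of `f` on the unit interval;
for `t` in that interval the restriction is invisible. -/
theorem antiPrimitive_eq (f : ℝ → E) {t : ℝ} (ht : t ∈ Icc (0 : ℝ) 1) :
    antiPrimitive f t = (∫ x in (0 : ℝ)..t, f x) - (1 / 2 : ℝ) • ∫ x in (0 : ℝ)..1, f x := by
  unfold antiPrimitive
  rw [integral_of_le ht.1, integral_of_le ht.1, integral_of_le zero_le_one,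
    Measure.restrict_restrict measurableSet_Ioc,
    inter_eq_left.2 (Ioc_subset_Ioc_right ht.2)]

theorem antiPrimitive_one (f : ℝ → E) : antiPrimitive f 1 = -antiPrimitive f 0 := by
  rw [antiPrimitive_eq f ⟨zero_le_one, le_rfl⟩, antiPrimitive_eq f ⟨le_rfl, zero_le_one⟩,
    integral_same]
  module

theorem continuous_antiPrimitive_Lp (u : Lp E 2 unitMeasure) : Continuous (antiPrimitive u) :=
  continuous_antiPrimitive (integrable_Lp_two u)

theorem norm_antiPrimitive_Lp_le (u : Lp E 2 unitMeasure) (t : ℝ) :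
    ‖antiPrimitive u t‖ ≤ 2 * ‖u‖ :=
  (norm_antiPrimitive_le (integrable_Lp_two u) t).trans
    (by linarith [integral_norm_le_norm_Lp_two u])

theorem antiPrimitive_Lp_add (u v : Lp E 2 unitMeasure) (t : ℝ) :
    antiPrimitive (u + v : Lp E 2 unitMeasure) t = antiPrimitive u t + antiPrimitive v t := by
  rw [← antiPrimitive_add (integrable_Lp_two u) (integrable_Lp_two v),
    antiPrimitive_congr_ae (Lp.coeFn_add u v)]
  rfl

theorem antiPrimitive_Lp_smul (c : ℝ) (u : Lp E 2 unitMeasure) (t : ℝ) :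
    antiPrimitive (c • u : Lp E 2 unitMeasure) t = c • antiPrimitive u t := by
  rw [← antiPrimitive_smul, antiPrimitive_congr_ae (Lp.coeFn_smul c u)]
  rfl

/-- Evaluation at `t` of the antiperiodic primitive, as an operator on `L²`. -/
noncomputable def antiPrimitiveCLM (t : ℝ) : Lp E 2 unitMeasure →L[ℝ] E :=
  LinearMap.mkContinuous
    { toFun := fun u => antiPrimitive u t
      map_add' := fun u v => antiPrimitive_Lp_add u v t
      map_smul' := fun c u => antiPrimitive_Lp_smul c u t } 2
    fun u => norm_antiPrimitive_Lp_le u t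

end AntiPrimitive

/-- Sequential Banach–Alaoglu in the dual, carried back by the Riesz isomorphism. -/
theorem exists_weakly_convergent_subseq {H : Type*} [NormedAddCommGroup H]
    [InnerProductSpace ℝ H] [CompleteSpace H] [TopologicalSpace.SeparableSpace H] {u : ℕ → H}
    {R : ℝ} (hu : ∀ k, ‖u k‖ ≤ R) :
    ∃ (v : H) (φ : ℕ → ℕ), StrictMono φ ∧
      ∀ ℓ : H →L[ℝ] ℝ, Tendsto (fun k => ℓ (u (φ k))) atTop (𝓝 (ℓ v)) := by
  have hmem : ∀ k, StrongDual.toWeakDual (InnerProductSpace.toDual ℝ H (u k)) ∈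
      WeakDual.toStrongDual ⁻¹' Metric.closedBall (0 : StrongDual ℝ H) R := by
    intro k
    rw [mem_preimage, mem_closedBall_zero_iff]
    exact ((InnerProductSpace.toDual ℝ H).norm_map (u k)).le.trans (hu k)
  obtain ⟨w, -, φ, hφ, hw⟩ := WeakDual.isSeqCompact_closedBall ℝ H 0 R hmem
  refine ⟨(InnerProductSpace.toDual ℝ H).symm (WeakDual.toStrongDual w), φ, hφ, fun ℓ => ?_⟩
  have h1 := ((WeakDual.eval_continuous ((InnerProductSpace.toDual ℝ H).symm ℓ)).tendsto w).comp hw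
  have h2 : ∀ z : H, ℓ z = inner ℝ z ((InnerProductSpace.toDual ℝ H).symm ℓ) := by
    intro z
    rw [real_inner_comm, InnerProductSpace.toDual_symm_apply]
  simp only [h2]
  rw [InnerProductSpace.toDual_symm_apply]
  exact h1

/-! ### The constraint set and the direct method -/

section Constraint

variable {n : ℕ} {V : EuclideanSpace ℝ (Fin n) → ℝ}

theorem tendsto_integral_antiPrimitive {F : EuclideanSpace ℝ (Fin n) → ℝ} (hF : Continuous F)
    {ι : Type*} {l : Filter ι} [l.IsCountablyGenerated]
    {u : ι → Lp (EuclideanSpace ℝ (Fin n)) 2 unitMeasure}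
    {v : Lp (EuclideanSpace ℝ (Fin n)) 2 unitMeasure} {R : ℝ} (hR : ∀ᶠ i in l, ‖u i‖ ≤ R)
    (h : ∀ t, Tendsto (fun i => antiPrimitive (u i) t) l (𝓝 (antiPrimitive v t))) :
    Tendsto (fun i => ∫ t, F (antiPrimitive (u i) t) ∂unitMeasure) l
      (𝓝 (∫ t, F (antiPrimitive v t) ∂unitMeasure)) := by
  refine tendsto_integral_comp hF (fun i => continuous_antiPrimitive_Lp (u i)) (R := 2 * R) ?_
    (Eventually.of_forall h)
  filter_upwards [hR] with i hi t
  exact (norm_antiPrimitive_Lp_le (u i) t).trans (by linarith)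

theorem continuous_integral_antiPrimitive {F : EuclideanSpace ℝ (Fin n) → ℝ}
    (hF : Continuous F) :
    Continuous fun u : Lp (EuclideanSpace ℝ (Fin n)) 2 unitMeasure =>
      ∫ t, F (antiPrimitive u t) ∂unitMeasure := by
  refine continuous_iff_continuousAt.2 fun u => ?_
  refine tendsto_integral_antiPrimitive hF (l := 𝓝 u) (u := id) (R := ‖u‖ + 1) ?_ fun t => ?_
  · exact (continuous_norm.tendsto u).eventually (eventually_le_nhds (by simp))
  · exact (antiPrimitiveCLM t).continuous.tendsto u

/-- The mean of the virial energy along the antiperiodic primitive of `u`. -/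
noncomputable def virialMean (V : EuclideanSpace ℝ (Fin n) → ℝ)
    (u : Lp (EuclideanSpace ℝ (Fin n)) 2 unitMeasure) : ℝ :=
  ∫ t, virialEnergy V (antiPrimitive u t) ∂unitMeasure

/-- The mean of `h - V` along the antiperiodic primitive of `u`. -/
noncomputable def potentialGap (V : EuclideanSpace ℝ (Fin n) → ℝ) (h : ℝ)
    (u : Lp (EuclideanSpace ℝ (Fin n)) 2 unitMeasure) : ℝ :=
  ∫ t, (h - V (antiPrimitive u t)) ∂unitMeasure

/-- The fixed-energy functional `½ ∫ |q'|² ∫ (h - V(q))`, in terms of `u = q'`. -/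
noncomputable def fixedEnergyAction (V : EuclideanSpace ℝ (Fin n) → ℝ) (h : ℝ)
    (u : Lp (EuclideanSpace ℝ (Fin n)) 2 unitMeasure) : ℝ :=
  1 / 2 * ‖u‖ ^ 2 * potentialGap V h u

theorem continuous_virialMean (hV : ContDiff ℝ 2 V) : Continuous (virialMean V) :=
  continuous_integral_antiPrimitive (continuous_virialEnergy hV)

theorem virialMean_zero : virialMean V 0 = V 0 := by
  have h : ∀ t, antiPrimitive (0 : Lp (EuclideanSpace ℝ (Fin n)) 2 unitMeasure) t = 0 :=
    fun t => (antiPrimitiveCLM t).map_zero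
  simp only [virialMean, h, virialEnergy_zero, MeasureTheory.integral_const, probReal_univ,
    one_smul]

theorem integrable_comp_antiPrimitive {F : EuclideanSpace ℝ (Fin n) → ℝ} (hF : Continuous F)
    (u : Lp (EuclideanSpace ℝ (Fin n)) 2 unitMeasure) :
    Integrable (fun t => F (antiPrimitive u t)) unitMeasure :=
  integrable_unitMeasure_of_continuous (hF.comp (continuous_antiPrimitive_Lp u))

theorem potentialGap_eq (hV : ContDiff ℝ 2 V) (h : ℝ)
    (u : Lp (EuclideanSpace ℝ (Fin n)) 2 unitMeasure) :
    potentialGap V h u = h - ∫ t, V (antiPrimitive u t) ∂unitMeasure := by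
  rw [potentialGap, MeasureTheory.integral_sub (integrable_const _)
    (integrable_comp_antiPrimitive hV.continuous u)]
  simp

theorem virialMean_smul_lt (hV : ContDiff ℝ 2 V)
    (V2 : ∀ q, q ≠ 0 → 0 < fderiv ℝ V q q)
    (V3 : ∀ q, q ≠ 0 → 3 * fderiv ℝ V q q + fderiv ℝ (fderiv ℝ V) q q q ≠ 0)
    {u : Lp (EuclideanSpace ℝ (Fin n)) 2 unitMeasure} (hu : virialMean V u ≠ V 0)
    {s r : ℝ} (hs : 0 ≤ s) (hsr : s < r) :
    virialMean V (s • u) < virialMean V (r • u) := by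
  have hG := continuous_virialEnergy hV
  have hi := integrable_comp_antiPrimitive hG (r • u)
  have hj := integrable_comp_antiPrimitive hG (s • u)
  rw [← sub_pos, virialMean, virialMean, ← MeasureTheory.integral_sub hi hj]
  have hnn : ∀ t, 0 ≤ virialEnergy V (antiPrimitive (r • u : Lp _ 2 unitMeasure) t)
      - virialEnergy V (antiPrimitive (s • u : Lp _ 2 unitMeasure) t) := by
    intro t
    rw [antiPrimitive_Lp_smul, antiPrimitive_Lp_smul, sub_nonneg]
    exact monotoneOn_virialEnergy_ray hV V2 V3 _ (mem_Ici.2 hs) (mem_Ici.2 (hs.trans hsr.le))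
      hsr.le
  refine lt_of_le_of_ne (integral_nonneg hnn) fun h0 => hu ?_
  rw [eq_comm, integral_eq_zero_iff_of_nonneg hnn (hi.sub hj)] at h0
  have hz : ∀ᵐ t ∂unitMeasure, virialEnergy V (antiPrimitive u t) = V 0 := by
    filter_upwards [h0] with t ht
    rcases eq_or_ne (antiPrimitive u t) 0 with h1 | h1
    · rw [h1, virialEnergy_zero]
    · have := strictMonoOn_virialEnergy_ray hV V2 V3 h1 (mem_Ici.2 hs)
        (mem_Ici.2 (hs.trans hsr.le)) hsr
      simp only [antiPrimitive_Lp_smul, Pi.zero_apply] at ht this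
      linarith
  rw [virialMean, integral_congr_ae hz]
  simp

/-- A path with opposite ends cannot rest at `q`, but it can run from `-q` to `q` in a short time
and then stay. Its virial mean tends to the virial energy of `q`, and the level `h` is met on the
segment from zero to such a path. -/
theorem exists_virialMean_eq (hV : ContDiff ℝ 2 V) {h : ℝ} (h0 : V 0 ≤ h)
    {q : EuclideanSpace ℝ (Fin n)} (hq : h < virialEnergy V q) :
    ∃ u, virialMean V u = h := by
  -- Speed times duration is `2q`, the displacement from `-q` to `q`; so the `L¹` norm, which bounds
  -- the path, does not depend on `k`.
  set f : ℕ → ℝ → EuclideanSpace ℝ (Fin n) := fun k =>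
    indicator {x | x ≤ 1 / ((k : ℝ) + 1)} (fun _ => (2 * ((k : ℝ) + 1)) • q) with hf
  have hm : ∀ k, MemLp (f k) 2 unitMeasure := fun k =>
    (memLp_const _).indicator measurableSet_Iic
  have hδ : ∀ k : ℕ, 0 < 1 / ((k : ℝ) + 1) ∧ 1 / ((k : ℝ) + 1) ≤ 1 := fun k =>
    ⟨by positivity, by rw [div_le_one (by positivity)]; simp⟩
  have hint : ∀ k, ∫ x, ‖f k x‖ ∂unitMeasure = 2 * ‖q‖ := by
    intro k
    simp only [hf, norm_indicator_eq_indicator_norm]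
    rw [← integral_of_le zero_le_one,
      intervalIntegral.integral_indicator ⟨(hδ k).1.le, (hδ k).2⟩]
    rw [intervalIntegral.integral_const, norm_smul, Real.norm_of_nonneg (by positivity)]
    have : (k : ℝ) + 1 ≠ 0 := by positivity
    simp only [smul_eq_mul, sub_zero]
    field_simp
  have hval : ∀ (k : ℕ) (t : ℝ), 1 / ((k : ℝ) + 1) ≤ t → t ≤ 1 → antiPrimitive (f k) t = q := by
    intro k t h1 h2
    rw [antiPrimitive_eq _ ⟨(hδ k).1.le.trans h1, h2⟩, hf]
    simp only
    rw [intervalIntegral.integral_indicator ⟨(hδ k).1.le, h1⟩,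
      intervalIntegral.integral_indicator ⟨(hδ k).1.le, (hδ k).2⟩,
      intervalIntegral.integral_const, sub_zero, smul_smul]
    have h3 : 1 / ((k : ℝ) + 1) * (2 * ((k : ℝ) + 1)) = 2 := by
      have : (k : ℝ) + 1 ≠ 0 := by positivity
      field_simp
    rw [h3]
    module
  have hlim : Tendsto (fun k => virialMean V (hm k).toLp) atTop (𝓝 (virialEnergy V q)) := by
    have h1 := tendsto_integral_comp (l := atTop) (continuous_virialEnergy hV)
      (x := fun k => antiPrimitive (f k)) (y := fun _ => q) (R := 4 * ‖q‖)
      (fun k => continuous_antiPrimitive ((hm k).integrable (by norm_num)))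
      (Eventually.of_forall fun k t =>
        (norm_antiPrimitive_le ((hm k).integrable (by norm_num)) t).trans
          (by rw [hint]; linarith)) ?_
    · simp only [MeasureTheory.integral_const, probReal_univ, one_smul] at h1
      refine h1.congr fun k => ?_
      rw [virialMean, antiPrimitive_congr_ae (hm k).coeFn_toLp]
    · filter_upwards [ae_restrict_mem measurableSet_Ioc] with t ht
      refine tendsto_const_nhds.congr' ?_
      filter_upwards [(tendsto_one_div_add_atTop_nhds_zero_nat (𝕜 := ℝ)).eventually
        (eventually_le_nhds ht.1)] with k hk
      exact (hval k t hk ht.2).symm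
  obtain ⟨k, hk⟩ := (hlim.eventually (lt_mem_nhds hq)).exists
  have hc : Continuous fun s : ℝ => virialMean V (s • (hm k).toLp) :=
    (continuous_virialMean hV).comp (by fun_prop)
  obtain ⟨s, -, hs⟩ := intermediate_value_Icc zero_le_one hc.continuousOn
    (show h ∈ Icc _ _ from ⟨by simpa [virialMean_zero] using h0, by simpa using hk.le⟩)
  exact ⟨_, hs⟩

/-- Average `(μ₁ + 2) V ≤ 2 (V + ½ V'(q)q) + μ₂` along the path. -/
theorem potentialGap_lower_bound (hV : ContDiff ℝ 2 V) {h μ₁ μ₂ : ℝ} (hμ₁ : 0 < μ₁)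
    (V4 : ∀ q, μ₁ * V q - μ₂ ≤ fderiv ℝ V q q)
    {u : Lp (EuclideanSpace ℝ (Fin n)) 2 unitMeasure} (hu : virialMean V u = h) :
    (μ₁ * h - μ₂) / (μ₁ + 2) ≤ potentialGap V h u := by
  have h1 : ∫ t, (μ₁ + 2) * V (antiPrimitive u t) ∂unitMeasure ≤
      ∫ t, (2 * virialEnergy V (antiPrimitive u t) + μ₂) ∂unitMeasure := by
    refine integral_mono ((integrable_comp_antiPrimitive hV.continuous u).const_mul _)
      (((integrable_comp_antiPrimitive (continuous_virialEnergy hV) u).const_mul _).add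
        (integrable_const _)) fun t => ?_
    have := V4 (antiPrimitive u t)
    simp only [virialEnergy]
    linarith
  rw [MeasureTheory.integral_const_mul, MeasureTheory.integral_add
    ((integrable_comp_antiPrimitive (continuous_virialEnergy hV) u).const_mul _)
    (integrable_const _), MeasureTheory.integral_const_mul] at h1
  change _ ≤ 2 * virialMean V u + _ at h1
  simp only [hu, MeasureTheory.integral_const, probReal_univ, one_smul] at h1
  rw [potentialGap_eq hV, div_le_iff₀ (by linarith)]
  linarith

theorem exists_minimizer (hV : ContDiff ℝ 2 V) {h μ₁ μ₂ : ℝ} (hμ₁ : 0 < μ₁)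
    (V4 : ∀ q, μ₁ * V q - μ₂ ≤ fderiv ℝ V q q) (hμ : μ₂ / μ₁ < h)
    (hne : ∃ u, virialMean V u = h) :
    ∃ u, virialMean V u = h ∧
      ∀ v, virialMean V v = h → fixedEnergyAction V h u ≤ fixedEnergyAction V h v := by
  set c := (μ₁ * h - μ₂) / (μ₁ + 2) with hc
  have hc0 : 0 < c := by
    rw [div_lt_iff₀ hμ₁] at hμ
    exact div_pos (by linarith) (by linarith)
  have hgap : ∀ u, virialMean V u = h → c ≤ potentialGap V h u := fun u hu =>
    potentialGap_lower_bound hV hμ₁ V4 hu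
  set S := fixedEnergyAction V h '' {u | virialMean V u = h} with hS
  have hSne : S.Nonempty := Set.Nonempty.image _ hne
  have hSbdd : BddBelow S := ⟨0, by
    rintro _ ⟨u, hu, rfl⟩
    have := hc0.le.trans (hgap u hu)
    unfold fixedEnergyAction
    positivity⟩
  obtain ⟨a, -, ha, haS⟩ := exists_seq_tendsto_sInf hSne hSbdd
  choose u huM hua using haS
  obtain ⟨B, hB⟩ := ha.bddAbove_range
  have hbound : ∀ k, ‖u k‖ ≤ Real.sqrt (2 * B / c) := by
    intro k
    refine Real.le_sqrt_of_sq_le ?_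
    rw [le_div_iff₀ hc0]
    have h1 : fixedEnergyAction V h (u k) ≤ B := by
      rw [hua]
      exact hB ⟨k, rfl⟩
    unfold fixedEnergyAction at h1
    have h2 := mul_le_mul_of_nonneg_left (hgap _ (huM k)) (sq_nonneg ‖u k‖)
    linarith
  have : Fact ((2 : ENNReal) ≠ ⊤) := ⟨by norm_num⟩
  obtain ⟨v, φ, hφ, hv⟩ := exists_weakly_convergent_subseq hbound
  -- Evaluation of the path is bounded linear in the velocity, so weak convergence of velocities
  -- gives pointwise convergence of paths; the constraint and the gap then pass to the limit.
  have hpt : ∀ t, Tendsto (fun k => antiPrimitive (u (φ k)) t) atTop (𝓝 (antiPrimitive v t)) := by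
    intro t
    refine (PiLp.homeomorph 2 (fun _ : Fin n => ℝ)).isInducing.tendsto_nhds_iff.2
      (tendsto_pi_nhds.2 fun i => ?_)
    exact hv ((EuclideanSpace.proj i : EuclideanSpace ℝ (Fin n) →L[ℝ] ℝ).comp
      (antiPrimitiveCLM t))
  have hbe : ∀ᶠ k in atTop, ‖u (φ k)‖ ≤ Real.sqrt (2 * B / c) :=
    Eventually.of_forall fun k => hbound _
  have hvM : virialMean V v = h := by
    refine tendsto_nhds_unique (tendsto_integral_antiPrimitive (continuous_virialEnergy hV)
      hbe hpt) (tendsto_const_nhds.congr fun k => (huM (φ k)).symm)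
  have hP : Tendsto (fun k => potentialGap V h (u (φ k))) atTop (𝓝 (potentialGap V h v)) :=
    tendsto_integral_antiPrimitive (F := fun q => h - V q)
      (continuous_const.sub hV.continuous) hbe hpt
  have hPv : 0 < potentialGap V h v := hc0.trans_le (hgap v hvM)
  have hJ : Tendsto (fun k => fixedEnergyAction V h (u (φ k))) atTop (𝓝 (sInf S)) := by
    simp only [hua]
    exact ha.comp hφ.tendsto_atTop
  refine ⟨v, hvM, fun w hw => ?_⟩
  refine le_trans ?_ (csInf_le hSbdd ⟨w, hw, rfl⟩)
  have hinner : Tendsto (fun k => inner ℝ v (u (φ k))) atTop (𝓝 (‖v‖ ^ 2)) := by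
    rw [← real_inner_self_eq_norm_sq]
    exact hv (innerSL ℝ v)
  -- Weak lower semicontinuity through `⟨v, u⟩ - ½ ‖v‖² ≤ ½ ‖u‖²`, multiplied by the positive gap.
  have hlow : Tendsto (fun k => (inner ℝ v (u (φ k)) - 1 / 2 * ‖v‖ ^ 2)
      * potentialGap V h (u (φ k))) atTop (𝓝 (fixedEnergyAction V h v)) := by
    have := (hinner.sub_const (1 / 2 * ‖v‖ ^ 2)).mul hP
    refine (congrArg _ (congrArg 𝓝 ?_)).mp this
    unfold fixedEnergyAction
    ring
  refine le_of_tendsto_of_tendsto' hlow hJ fun k => ?_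
  refine mul_le_mul_of_nonneg_right ?_ (hc0.le.trans (hgap _ (huM _)))
  have h1 := sq_nonneg (‖v‖ - ‖u (φ k)‖)
  have h2 := real_inner_le_norm v (u (φ k))
  nlinarith

end Constraint

/-! ### The minimizer is a free critical point -/

section EulerLagrange

variable {n : ℕ} {V : EuclideanSpace ℝ (Fin n) → ℝ}

theorem sq_mul_potentialGap_smul_le (hV : ContDiff ℝ 2 V)
    (V2 : ∀ q, q ≠ 0 → 0 < fderiv ℝ V q q)
    (V3 : ∀ q, q ≠ 0 → 3 * fderiv ℝ V q q + fderiv ℝ (fderiv ℝ V) q q q ≠ 0)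
    {h : ℝ} {u : Lp (EuclideanSpace ℝ (Fin n)) 2 unitMeasure} (hu : virialMean V u = h)
    {s : ℝ} (hs : 0 ≤ s) :
    s ^ 2 * potentialGap V h (s • u) ≤ potentialGap V h u := by
  have hVs := integrable_comp_antiPrimitive hV.continuous (s • u)
  have hVu := integrable_comp_antiPrimitive hV.continuous u
  have h1 : ∫ t, (s ^ 2 - 1) * virialEnergy V (antiPrimitive u t) ∂unitMeasure ≤
      ∫ t, (s ^ 2 * V (antiPrimitive (s • u : Lp _ 2 unitMeasure) t)
        - V (antiPrimitive u t)) ∂unitMeasure := by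
    refine integral_mono ((integrable_comp_antiPrimitive (continuous_virialEnergy hV) u).const_mul _)
      ((hVs.const_mul _).sub hVu) fun t => ?_
    simp only [antiPrimitive_Lp_smul]
    exact sq_sub_one_mul_virialEnergy_le hV V2 V3 _ hs
  rw [MeasureTheory.integral_const_mul, MeasureTheory.integral_sub (hVs.const_mul _) hVu,
    MeasureTheory.integral_const_mul] at h1
  change (s ^ 2 - 1) * virialMean V u ≤ _ at h1
  rw [hu] at h1
  rw [potentialGap_eq hV, potentialGap_eq hV]
  linarith

/-- The virial mean is strictly below `h` at `(1 - δ)u` and strictly above at `(1 + δ)u`; both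
persist for nearby `w`, and the intermediate value theorem applies on the ray of `w`. -/
theorem eventually_exists_smul_virialMean_eq (hV : ContDiff ℝ 2 V)
    (V2 : ∀ q, q ≠ 0 → 0 < fderiv ℝ V q q)
    (V3 : ∀ q, q ≠ 0 → 3 * fderiv ℝ V q q + fderiv ℝ (fderiv ℝ V) q q q ≠ 0)
    {h : ℝ} (h0 : V 0 < h) {u : Lp (EuclideanSpace ℝ (Fin n)) 2 unitMeasure}
    (hu : virialMean V u = h) {δ : ℝ} (hδ : 0 < δ) (hδ1 : δ ≤ 1) :
    ∀ᶠ w in 𝓝 u, ∃ s ∈ Icc (1 - δ) (1 + δ), virialMean V (s • w) = h := by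
  have hne : virialMean V u ≠ V 0 := by
    rw [hu]
    exact h0.ne'
  have hc := continuous_virialMean hV
  have hlow : virialMean V ((1 - δ) • u) < h := by
    have := virialMean_smul_lt hV V2 V3 hne (sub_nonneg.2 hδ1) (sub_lt_self 1 hδ)
    rwa [one_smul, hu] at this
  have hup : h < virialMean V ((1 + δ) • u) := by
    have := virialMean_smul_lt hV V2 V3 hne zero_le_one (lt_add_of_pos_right 1 hδ)
    rwa [one_smul, hu] at this
  have e1 : ∀ᶠ w in 𝓝 u, virialMean V ((1 - δ) • w) < h :=
    (hc.comp (continuous_const_smul (1 - δ))).continuousAt.eventually_lt continuousAt_const hlow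
  have e2 : ∀ᶠ w in 𝓝 u, h < virialMean V ((1 + δ) • w) :=
    continuousAt_const.eventually_lt
      (hc.comp (continuous_const_smul (1 + δ))).continuousAt hup
  filter_upwards [e1, e2] with w h1 h2
  have hcs : Continuous fun s : ℝ => virialMean V (s • w) := hc.comp (by fun_prop)
  exact intermediate_value_Icc (by linarith) hcs.continuousOn ⟨h1.le, h2.le⟩

theorem tendsto_difference_quotient {x y : EuclideanSpace ℝ (Fin n)} (hV : ContDiff ℝ 2 V)
    {s ε : ℕ → ℝ} (hs : Tendsto s atTop (𝓝 1)) (hε : Tendsto ε atTop (𝓝 0))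
    (hpos : ∀ k, 0 < ε k) :
    Tendsto (fun k => (V (s k • (x + ε k • y)) - V (s k • x)) / ε k) atTop
      (𝓝 (fderiv ℝ V x y)) := by
  -- Both points of the quotient move with `k`, so strict differentiability is needed.
  have hst : HasStrictFDerivAt V (fderiv ℝ V x) x :=
    hV.contDiffAt.hasStrictFDerivAt (by norm_num)
  have hp : Tendsto (fun k => (s k • (x + ε k • y), s k • x)) atTop (𝓝 (x, x)) := by
    have h1 := hs.smul ((tendsto_const_nhds (x := x)).add (hε.smul_const y))
    have h2 := hs.smul_const x
    simp only [zero_smul, add_zero, one_smul] at h1 h2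
    exact h1.prodMk_nhds h2
  have ho := hst.isLittleO.comp_tendsto hp
  have hO : ((fun p : EuclideanSpace ℝ (Fin n) × EuclideanSpace ℝ (Fin n) => p.1 - p.2) ∘
      fun k => (s k • (x + ε k • y), s k • x)) =O[atTop] ε := by
    have h1 : (fun k => s k • (ε k • y)) =O[atTop] fun k => (1 : ℝ) * (ε k * 1) := by
      refine (hs.isBigO_one ℝ).smul ((Asymptotics.isBigO_refl ε atTop).smul ?_)
      exact Asymptotics.isBigO_const_const y one_ne_zero atTop
    simpa [Function.comp_def, smul_add] using h1
  have hq := (ho.trans_isBigO hO).tendsto_div_nhds_zero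
  have hs' : Tendsto (fun k => s k * fderiv ℝ V x y) atTop (𝓝 (1 * fderiv ℝ V x y)) :=
    hs.mul_const _
  have := hq.add hs'
  rw [zero_add, one_mul] at this
  refine this.congr fun k => ?_
  have hk := (hpos k).ne'
  simp only [Function.comp_def, smul_add, add_sub_cancel_left, map_smul, smul_eq_mul]
  field_simp
  ring

/-- Scale `u + εv` back to the constraint by `s` and compare with `u`. Since `u` is maximal on its
own ray, its value may be replaced by the smaller one at `su`. It remains to divide by `ε`. -/
theorem euler_lagrange_nonneg (hV : ContDiff ℝ 2 V)
    (V2 : ∀ q, q ≠ 0 → 0 < fderiv ℝ V q q)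
    (V3 : ∀ q, q ≠ 0 → 3 * fderiv ℝ V q q + fderiv ℝ (fderiv ℝ V) q q q ≠ 0)
    {h : ℝ} (h0 : V 0 < h) {u : Lp (EuclideanSpace ℝ (Fin n)) 2 unitMeasure}
    (hu : virialMean V u = h)
    (hmin : ∀ v, virialMean V v = h → fixedEnergyAction V h u ≤ fixedEnergyAction V h v)
    (v : Lp (EuclideanSpace ℝ (Fin n)) 2 unitMeasure) :
    0 ≤ 2 * inner ℝ u v * potentialGap V h u
      - ‖u‖ ^ 2 * ∫ t, fderiv ℝ V (antiPrimitive u t) (antiPrimitive v t) ∂unitMeasure := by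
  have hex : ∀ k : ℕ, ∃ ε s : ℝ, (0 < ε ∧ ε < 1 / ((k : ℝ) + 1)) ∧
      s ∈ Icc (1 - 1 / ((k : ℝ) + 1 + 1)) (1 + 1 / ((k : ℝ) + 1 + 1)) ∧
      virialMean V (s • (u + ε • v)) = h := by
    intro k
    have h1 : Tendsto (fun ε : ℝ => u + ε • v) (𝓝[>] 0) (𝓝 u) := by
      have : Continuous fun ε : ℝ => u + ε • v := by fun_prop
      simpa using (this.tendsto 0).mono_left nhdsWithin_le_nhds
    have h2 := h1.eventually (eventually_exists_smul_virialMean_eq hV V2 V3 h0 hu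
      -- The extra `1` keeps `δ ≤ 1/2`, hence `s > 0`, already for `k = 0`.
      (δ := 1 / ((k : ℝ) + 1 + 1)) (by positivity)
      (by rw [div_le_one (by positivity)]; linarith [k.cast_nonneg (α := ℝ)]))
    obtain ⟨ε, ⟨s, hs, hs'⟩, hε⟩ := (h2.and
      (Ioo_mem_nhdsGT (show (0 : ℝ) < 1 / ((k : ℝ) + 1) by positivity))).exists
    exact ⟨ε, s, hε, hs, hs'⟩
  choose ε s hε hs hsM using hex
  have hlim := tendsto_one_div_add_atTop_nhds_zero_nat (𝕜 := ℝ)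
  have hlim' : Tendsto (fun k : ℕ => 1 / ((k : ℝ) + 1 + 1)) atTop (𝓝 0) := by
    simpa [Function.comp_def] using hlim.comp (tendsto_add_atTop_nat 1)
  have hε0 : Tendsto ε atTop (𝓝 0) :=
    tendsto_of_tendsto_of_tendsto_of_le_of_le tendsto_const_nhds hlim
      (fun k => (hε k).1.le) fun k => (hε k).2.le
  have hs1 : Tendsto s atTop (𝓝 1) := by
    refine tendsto_of_tendsto_of_tendsto_of_le_of_le (g := fun k : ℕ => 1 - 1 / ((k : ℝ) + 1 + 1))
      (h := fun k : ℕ => 1 + 1 / ((k : ℝ) + 1 + 1)) ?_ ?_ (fun k => (hs k).1) fun k => (hs k).2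
    · simpa using hlim'.const_sub 1
    · simpa using hlim'.const_add 1
  have hhalf : ∀ k : ℕ, 1 / ((k : ℝ) + 1 + 1) ≤ 1 / 2 := fun k =>
    one_div_le_one_div_of_le two_pos (by linarith [k.cast_nonneg (α := ℝ)])
  have hspos : ∀ k, 0 < s k := fun k => by linarith [(hs k).1, hhalf k]
  have hs2 : ∀ k, s k ≤ 2 := fun k => by linarith [(hs k).2, hhalf k]
  have hε1 : ∀ k, ε k ≤ 1 := fun k => (hε k).2.le.trans
    (by rw [div_le_one (by positivity)]; linarith [k.cast_nonneg (α := ℝ)])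
  set Q : ℕ → ℝ → ℝ := fun k t => (V (s k • (antiPrimitive u t + ε k • antiPrimitive v t))
    - V (s k • antiPrimitive u t)) / ε k with hQ
  have hcu := continuous_antiPrimitive_Lp u
  have hcv := continuous_antiPrimitive_Lp v
  have hVc := hV.continuous
  have hQlim : Tendsto (fun k => ∫ t, Q k t ∂unitMeasure) atTop
      (𝓝 (∫ t, fderiv ℝ V (antiPrimitive u t) (antiPrimitive v t) ∂unitMeasure)) := by
    set R := 4 * (‖u‖ + ‖v‖) with hR
    obtain ⟨C, hC⟩ := (isCompact_closedBall
      (0 : EuclideanSpace ℝ (Fin n)) R).exists_bound_of_continuousOn (hV.continuous_fderiv (by norm_num)).continuousOn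
    have hC0 : 0 ≤ C := (norm_nonneg _).trans
      (hC 0 (mem_closedBall_zero_iff.2 (by rw [norm_zero]; positivity)))
    refine tendsto_integral_of_dominated_convergence (fun _ => C * (4 * ‖v‖))
      (fun k => Continuous.aestronglyMeasurable (by fun_prop)) (integrable_const _) ?_ ?_
    · refine fun k => Eventually.of_forall fun t => ?_
      have hx := norm_antiPrimitive_Lp_le u t
      have hy := norm_antiPrimitive_Lp_le v t
      have hεy : ‖ε k • antiPrimitive v t‖ ≤ 2 * ‖v‖ := by
        rw [norm_smul, Real.norm_of_nonneg (hε k).1.le]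
        nlinarith [hε1 k, norm_nonneg (antiPrimitive v t)]
      have hball : ∀ z : EuclideanSpace ℝ (Fin n), ‖z‖ ≤ 2 * ‖u‖ + 2 * ‖v‖ →
          s k • z ∈ Metric.closedBall 0 R := by
        intro z hz
        rw [mem_closedBall_zero_iff, norm_smul, Real.norm_of_nonneg (hspos k).le]
        nlinarith [hs2 k, norm_nonneg z]
      have h1 := Convex.norm_image_sub_le_of_norm_fderiv_le
        (fun z _ => (hV.differentiable (by norm_num)) z) hC (convex_closedBall _ _)
        (hball (antiPrimitive u t) (by linarith [norm_nonneg v]))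
        (hball (antiPrimitive u t + ε k • antiPrimitive v t)
          ((norm_add_le _ _).trans (by linarith)))
      rw [← smul_sub, add_sub_cancel_left, norm_smul, norm_smul,
        Real.norm_of_nonneg (hspos k).le, Real.norm_of_nonneg (hε k).1.le] at h1
      simp only [hQ]
      rw [norm_div, Real.norm_of_nonneg (hε k).1.le, div_le_iff₀ (hε k).1]
      refine h1.trans ?_
      have h2 : s k * ‖antiPrimitive v t‖ ≤ 4 * ‖v‖ := by
        nlinarith [hs2 k, norm_nonneg (antiPrimitive v t)]
      calc C * (s k * (ε k * ‖antiPrimitive v t‖))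
          = C * (s k * ‖antiPrimitive v t‖) * ε k := by ring
        _ ≤ C * (4 * ‖v‖) * ε k := by
          have := (hε k).1.le
          gcongr
    · exact Eventually.of_forall fun t =>
        tendsto_difference_quotient hV hs1 hε0 fun k => (hε k).1
  have hgapdiff : ∀ k, potentialGap V h (s k • (u + ε k • v)) - potentialGap V h (s k • u) =
      -(ε k * ∫ t, Q k t ∂unitMeasure) := by
    intro k
    rw [potentialGap_eq hV, potentialGap_eq hV, ← MeasureTheory.integral_const_mul]
    have h1 : ∀ t, ε k * Q k t = V (antiPrimitive (s k • (u + ε k • v) : Lp _ 2 unitMeasure) t)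
        - V (antiPrimitive (s k • u : Lp _ 2 unitMeasure) t) := by
      intro t
      rw [antiPrimitive_Lp_smul, antiPrimitive_Lp_smul, antiPrimitive_Lp_add,
        antiPrimitive_Lp_smul, mul_div_cancel₀ _ (hε k).1.ne']
    simp only [h1]
    rw [MeasureTheory.integral_sub (integrable_comp_antiPrimitive hVc _)
      (integrable_comp_antiPrimitive hVc _)]
    ring
  have hineq : ∀ k, 0 ≤ (2 * inner ℝ u v + ε k * ‖v‖ ^ 2) *
      potentialGap V h (s k • (u + ε k • v)) - ‖u‖ ^ 2 * ∫ t, Q k t ∂unitMeasure := by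
    intro k
    have h1 := hmin _ (hsM k)
    have h2 := mul_le_mul_of_nonneg_left
      (sq_mul_potentialGap_smul_le hV V2 V3 hu (hspos k).le) (sq_nonneg ‖u‖)
    unfold fixedEnergyAction at h1
    rw [norm_smul, Real.norm_of_nonneg (hspos k).le, mul_pow] at h1
    have h3 : ‖u + ε k • v‖ ^ 2 = ‖u‖ ^ 2 + ε k * (2 * inner ℝ u v + ε k * ‖v‖ ^ 2) := by
      rw [norm_add_sq_real, inner_smul_right, norm_smul, Real.norm_of_nonneg (hε k).1.le]
      ring
    -- The factor `s²` is common to both terms and cancels, so no rate for `s → 1` is needed.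
    have h4 : 0 ≤ s k ^ 2 * (‖u + ε k • v‖ ^ 2 * potentialGap V h (s k • (u + ε k • v))
        - ‖u‖ ^ 2 * potentialGap V h (s k • u)) := by linarith
    have h5 := nonneg_of_mul_nonneg_right h4 (pow_pos (hspos k) 2)
    have h6 := hgapdiff k
    rw [h3] at h5
    have h7 : potentialGap V h (s k • u) = potentialGap V h (s k • (u + ε k • v))
        + ε k * ∫ t, Q k t ∂unitMeasure := by linarith
    rw [h7] at h5
    refine le_of_mul_le_mul_left ?_ (hε k).1
    linarith
  refine ge_of_tendsto' (x := atTop) ?_ hineq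
  have hgap : Tendsto (fun k => potentialGap V h (s k • (u + ε k • v))) atTop
      (𝓝 (potentialGap V h u)) := by
    have h1 : Continuous (potentialGap V h) :=
      continuous_integral_antiPrimitive (F := fun q => h - V q) (continuous_const.sub hVc)
    have h2 : Tendsto (fun k => s k • (u + ε k • v)) atTop (𝓝 u) := by
      simpa using hs1.smul ((tendsto_const_nhds (x := u)).add (hε0.smul_const v))
    exact (h1.tendsto u).comp h2
  have h1 : Tendsto (fun k => 2 * inner ℝ u v + ε k * ‖v‖ ^ 2) atTop (𝓝 (2 * inner ℝ u v)) := by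
    simpa using (hε0.mul_const (‖v‖ ^ 2)).const_add (2 * inner ℝ u v)
  exact (h1.mul hgap).sub (hQlim.const_mul _)

theorem euler_lagrange (hV : ContDiff ℝ 2 V)
    (V2 : ∀ q, q ≠ 0 → 0 < fderiv ℝ V q q)
    (V3 : ∀ q, q ≠ 0 → 3 * fderiv ℝ V q q + fderiv ℝ (fderiv ℝ V) q q q ≠ 0)
    {h : ℝ} (h0 : V 0 < h) {u : Lp (EuclideanSpace ℝ (Fin n)) 2 unitMeasure}
    (hu : virialMean V u = h)
    (hmin : ∀ v, virialMean V v = h → fixedEnergyAction V h u ≤ fixedEnergyAction V h v)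
    (v : Lp (EuclideanSpace ℝ (Fin n)) 2 unitMeasure) :
    2 * potentialGap V h u * inner ℝ u v =
      ‖u‖ ^ 2 * ∫ t, fderiv ℝ V (antiPrimitive u t) (antiPrimitive v t) ∂unitMeasure := by
  have h1 := euler_lagrange_nonneg hV V2 V3 h0 hu hmin v
  have h2 := euler_lagrange_nonneg hV V2 V3 h0 hu hmin ((-1 : ℝ) • v)
  simp only [antiPrimitive_Lp_smul, map_smul, inner_smul_right, smul_eq_mul] at h2
  rw [MeasureTheory.integral_const_mul] at h2
  linarith

end EulerLagrange

/-! ### Antiperiodic functions on the line -/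

section Antiperiodic

theorem Function.Antiperiodic.eq_of_eqOn_Icc {E : Type*} [AddCommGroup E] {f g : ℝ → E}
    (hf : Function.Antiperiodic f 1) (hg : Function.Antiperiodic g 1)
    (hfg : EqOn f g (Icc 0 1)) : f = g := by
  ext t
  have h1 := hfg ⟨Int.fract_nonneg t, (Int.fract_lt_one t).le⟩
  have h2 : Int.fract t = t - ⌊t⌋ • (1 : ℝ) := by
    rw [zsmul_one]
    rfl
  rw [h2, hf.sub_zsmul_eq, hg.sub_zsmul_eq] at h1
  rcases Int.units_eq_one_or ⌊t⌋.negOnePow with h | h <;> simpa [h] using h1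

theorem exists_antiperiodic_extension {E : Type*} [NormedAddCommGroup E] {q : ℝ → E}
    (hq : Continuous q) (h1 : q 1 = -q 0) :
    ∃ p : ℝ → E, Continuous p ∧ Function.Antiperiodic p 1 ∧ EqOn p q (Icc 0 1) := by
  -- One full period, of length two, compressed to the unit interval so that `Int.fract` can repeat
  -- it.
  set f : ℝ → E := fun s => if s ≤ 1 / 2 then q (2 * s) else -q (2 * s - 1) with hf
  have hfc : Continuous f := by
    refine Continuous.if_le (by fun_prop) (by fun_prop) continuous_id continuous_const ?_
    rintro x rfl
    norm_num [h1]
  have hf01 : f 0 = f 1 := by norm_num [hf, h1]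
  have hpc : Continuous fun t : ℝ => f (Int.fract (t / 2)) :=
    (hfc.continuousOn.comp_fract'' hf01).comp (continuous_id.div_const 2)
  refine ⟨fun t => f (Int.fract (t / 2)), hpc, fun t => ?_, fun t ht => ?_⟩
  · have hlo := Int.fract_nonneg (t / 2)
    have hhi := Int.fract_lt_one (t / 2)
    have hsplit := Int.fract_add_floor (t / 2)
    rcases lt_or_ge (Int.fract (t / 2)) (1 / 2) with h | h
    · have e : Int.fract ((t + 1) / 2) = Int.fract (t / 2) + 1 / 2 := by
        rw [Int.fract_eq_iff]
        exact ⟨by linarith, by linarith, ⌊t / 2⌋, by linarith⟩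
      simp only [e, hf, if_pos h.le]
      split_ifs with h'
      · have h0 : Int.fract (t / 2) = 0 := by linarith
        simp [h0, h1]
      · congr 2
        ring
    · have e : Int.fract ((t + 1) / 2) = Int.fract (t / 2) - 1 / 2 := by
        rw [Int.fract_eq_iff]
        exact ⟨by linarith, by linarith, ⌊t / 2⌋ + 1, by push_cast; linarith⟩
      have h2 : Int.fract (t / 2) - 1 / 2 ≤ 1 / 2 := by linarith
      simp only [e, hf, if_pos h2]
      split_ifs with h'
      · have h0 : Int.fract (t / 2) = 1 / 2 := by linarith
        simp [h0, h1]
      · rw [neg_neg]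
        congr 1
        ring
  · have e : Int.fract (t / 2) = t / 2 :=
      Int.fract_eq_self.2 ⟨by linarith [ht.1], by linarith [ht.2]⟩
    have h2 : t / 2 ≤ 1 / 2 := by linarith [ht.2]
    simp only [e, hf, if_pos h2]
    congr 1
    ring

variable {E : Type*} [NormedAddCommGroup E] [NormedSpace ℝ E] [CompleteSpace E]

/-- The primitive of `f` on the line that takes opposite values at `0` and `1`. -/
noncomputable def linePrimitive (f : ℝ → E) (t : ℝ) : E :=
  (∫ x in (0 : ℝ)..t, f x) - (1 / 2 : ℝ) • ∫ x in (0 : ℝ)..1, f x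

theorem hasDerivAt_linePrimitive {f : ℝ → E} (hf : Continuous f) (t : ℝ) :
    HasDerivAt (linePrimitive f) (f t) t :=
  (hf.integral_hasStrictDerivAt 0 t).hasDerivAt.sub_const _

theorem antiperiodic_linePrimitive {f : ℝ → E} (hf : Continuous f)
    (ha : Function.Antiperiodic f 1) : Function.Antiperiodic (linePrimitive f) 1 := by
  have hd : ∀ t, HasDerivAt (fun t => linePrimitive f (t + 1) + linePrimitive f t) 0 t := by
    intro t
    have h1 := ((hasDerivAt_linePrimitive hf (t + 1)).comp_add_const t 1).add
      (hasDerivAt_linePrimitive hf t)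
    rwa [ha t, neg_add_cancel] at h1
  intro t
  have h1 := is_const_of_deriv_eq_zero (fun t => (hd t).differentiableAt)
    (fun t => (hd t).deriv) t 0
  have h2 : linePrimitive f (0 + 1) + linePrimitive f 0 = 0 := by
    simp only [linePrimitive, zero_add, integral_same]
    module
  rw [h2] at h1
  exact eq_neg_of_add_eq_zero_left h1

end Antiperiodic

/-! ### Skew-adjointness of the primitive -/

section Adjoint

variable {E : Type*} [NormedAddCommGroup E] [InnerProductSpace ℝ E]

theorem memLp_antiPrimitive {w : ℝ → E} (hw : Integrable w unitMeasure) :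
    MemLp (antiPrimitive w) 2 unitMeasure :=
  MemLp.of_bound (continuous_antiPrimitive hw).aestronglyMeasurable _
    (Eventually.of_forall (norm_antiPrimitive_le hw))

variable [CompleteSpace E]

/-- Integration by parts: both primitives change sign from `0` to `1`, so the boundary terms cancel.
-/
theorem integral_inner_antiPrimitive_of_continuous {w v : ℝ → E} (hw : Continuous w)
    (hv : Continuous v) :
    ∫ t, inner ℝ (w t) (antiPrimitive v t) ∂unitMeasure =
      -∫ t, inner ℝ (antiPrimitive w t) (v t) ∂unitMeasure := by
  have hcw := continuous_antiPrimitive (integrable_unitMeasure_of_continuous hw)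
  have hcv := continuous_antiPrimitive (integrable_unitMeasure_of_continuous hv)
  have hlw : Continuous (linePrimitive w) :=
    continuous_iff_continuousAt.2 fun t => (hasDerivAt_linePrimitive hw t).continuousAt
  have hlv : Continuous (linePrimitive v) :=
    continuous_iff_continuousAt.2 fun t => (hasDerivAt_linePrimitive hv t).continuousAt
  rw [eq_neg_iff_add_eq_zero, ← MeasureTheory.integral_add
    (integrable_unitMeasure_of_continuous (hw.inner hcv))
    (integrable_unitMeasure_of_continuous (hcw.inner hv)),
    ← integral_of_le zero_le_one]
  have h1 : ∫ t in (0 : ℝ)..1, (inner ℝ (w t) (antiPrimitive v t)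
      + inner ℝ (antiPrimitive w t) (v t)) =
      ∫ t in (0 : ℝ)..1, (inner ℝ (linePrimitive w t) (v t)
        + inner ℝ (w t) (linePrimitive v t)) := by
    refine integral_congr fun t ht => ?_
    rw [uIcc_of_le zero_le_one] at ht
    simp only [antiPrimitive_eq _ ht, linePrimitive]
    ring
  rw [h1, integral_eq_sub_of_hasDerivAt
    (fun t _ => (hasDerivAt_linePrimitive hw t).inner ℝ (hasDerivAt_linePrimitive hv t))
    (((hlw.inner hv).add (hw.inner hlv)).intervalIntegrable _ _)]
  have h2 : ∀ f : ℝ → E, linePrimitive f 1 = -linePrimitive f 0 := by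
    intro f
    simp only [linePrimitive, integral_same]
    module
  rw [h2 w, h2 v, inner_neg_neg, sub_self]

/-- The antiperiodic primitive is a skew-adjoint operator of `L²`. -/
theorem integral_inner_antiPrimitive {w : ℝ → E} (hw : Continuous w)
    (v : Lp E 2 unitMeasure) :
    ∫ t, inner ℝ (w t) (antiPrimitive v t) ∂unitMeasure =
      -inner ℝ (memLp_antiPrimitive (integrable_unitMeasure_of_continuous hw)).toLp v := by
  have hd := BoundedContinuousFunction.toLp_denseRange (p := 2) E unitMeasure ℝ (by norm_num)
  refine isClosed_property hd (p := fun v : Lp E 2 unitMeasure =>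
      ∫ t, inner ℝ (w t) (antiPrimitive v t) ∂unitMeasure =
      -inner ℝ (memLp_antiPrimitive (integrable_unitMeasure_of_continuous hw)).toLp v)
    (isClosed_eq ?_ (by fun_prop)) (fun f => ?_) v
  · refine continuous_iff_continuousAt.2 fun v => ?_
    refine tendsto_integral_filter_of_dominated_convergence
      (fun t => ‖w t‖ * (2 * (‖v‖ + 1)))
      (Eventually.of_forall fun u =>
        (hw.inner (continuous_antiPrimitive_Lp u)).aestronglyMeasurable) ?_
      (integrable_unitMeasure_of_continuous (hw.norm.mul continuous_const)) ?_
    · filter_upwards [(continuous_norm.tendsto v).eventually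
        (eventually_le_nhds (lt_add_one ‖v‖))] with u hu
      refine Eventually.of_forall fun t => (norm_inner_le_norm _ _).trans ?_
      have := norm_antiPrimitive_Lp_le u t
      gcongr
      linarith
    · exact Eventually.of_forall fun t =>
        tendsto_const_nhds.inner ((antiPrimitiveCLM t).continuous.tendsto v)
  · have hf := BoundedContinuousFunction.coeFn_toLp 2 unitMeasure ℝ f
    rw [antiPrimitive_congr_ae hf, integral_inner_antiPrimitive_of_continuous hw f.continuous,
      L2.inner_def]
    congr 1
    refine integral_congr_ae ?_
    filter_upwards [hf, (memLp_antiPrimitive (integrable_unitMeasure_of_continuous hw)).coeFn_toLp]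
      with t h1 h2
    rw [h1, h2]

end Adjoint

/-! ### The gradient of an even potential -/

section Gradient

variable {n : ℕ} {V : EuclideanSpace ℝ (Fin n) → ℝ}

theorem inner_gradient (x y : EuclideanSpace ℝ (Fin n)) :
    inner ℝ (gradient V x) y = fderiv ℝ V x y := by
  rw [gradient, InnerProductSpace.toDual_symm_apply]

theorem continuous_gradient (hV : ContDiff ℝ 2 V) : Continuous (gradient V) :=
  (InnerProductSpace.toDual ℝ (EuclideanSpace ℝ (Fin n))).symm.continuous.comp
    (hV.continuous_fderiv (by norm_num))

theorem gradient_neg (hV : ContDiff ℝ 2 V) (V1 : ∀ q, V (-q) = V q)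
    (x : EuclideanSpace ℝ (Fin n)) : gradient V (-x) = -gradient V x := by
  have h1 : HasFDerivAt V (fderiv ℝ V (-x)) (-x) :=
    ((hV.differentiable (by norm_num)) _).hasFDerivAt
  have h2 : HasFDerivAt (fun y => V (-y)) ((fderiv ℝ V (-x)).comp
      (-ContinuousLinearMap.id ℝ (EuclideanSpace ℝ (Fin n)))) x :=
    h1.comp x (hasFDerivAt_id x).neg
  simp only [V1] at h2
  have h3 : fderiv ℝ V x = -fderiv ℝ V (-x) := by
    rw [h2.fderiv]
    ext y
    simp
  rw [gradient, gradient, h3, map_neg, neg_neg]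

end Gradient

/-! ### From critical points to periodic solutions -/

section Solution

variable {n : ℕ} {V : EuclideanSpace ℝ (Fin n) → ℝ}

/-- A critical point of the action is, up to a factor, the skew-adjoint primitive of the force. -/
theorem eq_neg_smul_antiPrimitive_gradient (hV : ContDiff ℝ 2 V) {h : ℝ}
    {u : Lp (EuclideanSpace ℝ (Fin n)) 2 unitMeasure} (hP : 0 < potentialGap V h u)
    (hEL : ∀ v : Lp (EuclideanSpace ℝ (Fin n)) 2 unitMeasure,
      2 * potentialGap V h u * inner ℝ u v =
        ‖u‖ ^ 2 * ∫ t, fderiv ℝ V (antiPrimitive u t) (antiPrimitive v t) ∂unitMeasure) :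
    u =ᵐ[unitMeasure] fun t => -(‖u‖ ^ 2 / (2 * potentialGap V h u)) •
      antiPrimitive (fun t => gradient V (antiPrimitive u t)) t := by
  have hw : Continuous fun t => gradient V (antiPrimitive u t) :=
    (continuous_gradient hV).comp (continuous_antiPrimitive_Lp u)
  have hm := memLp_antiPrimitive (integrable_unitMeasure_of_continuous hw)
  have key : u = (-(‖u‖ ^ 2 / (2 * potentialGap V h u))) • hm.toLp := by
    refine ext_inner_right ℝ fun v => ?_
    have h1 := hEL v
    simp only [← inner_gradient] at h1
    rw [integral_inner_antiPrimitive hw] at h1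
    rw [inner_smul_left]
    simp only [conj_trivial]
    field_simp
    linarith
  have h2 := Lp.coeFn_smul (-(‖u‖ ^ 2 / (2 * potentialGap V h u))) hm.toLp
  rw [← key] at h2
  filter_upwards [h2, hm.coeFn_toLp] with t h3 h4
  rw [h3, Pi.smul_apply, h4]

theorem contDiff_two_of_hasDerivAt {E : Type*} [NormedAddCommGroup E] [NormedSpace ℝ E]
    {f f' f'' : ℝ → E} (hf : ∀ t, HasDerivAt f (f' t) t) (hf' : ∀ t, HasDerivAt f' (f'' t) t)
    (hc : Continuous f'') : ContDiff ℝ 2 f := by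
  have e1 : deriv f = f' := funext fun t => (hf t).deriv
  have e2 : deriv f' = f'' := funext fun t => (hf' t).deriv
  have h1 : ContDiff ℝ 1 f' := contDiff_one_iff_deriv.2
    ⟨fun t => (hf' t).differentiableAt, by rwa [e2]⟩
  have h2 : ContDiff ℝ (1 + 1) f := contDiff_succ_iff_deriv.2
    ⟨fun t => (hf t).differentiableAt, by simp, by rwa [e1]⟩
  rwa [one_add_one_eq_two] at h2

/-- A critical point of the action yields an antiperiodic solution of the rescaled equation. -/
theorem exists_antiperiodic_solution (hV : ContDiff ℝ 2 V) (V1 : ∀ q, V (-q) = V q) {c : ℝ}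
    {u : Lp (EuclideanSpace ℝ (Fin n)) 2 unitMeasure}
    (hu : u =ᵐ[unitMeasure] fun t => -c •
      antiPrimitive (fun t => gradient V (antiPrimitive u t)) t) :
    ∃ p p' : ℝ → EuclideanSpace ℝ (Fin n), Function.Antiperiodic p 1 ∧
      EqOn p (antiPrimitive u) (Icc 0 1) ∧ p' =ᵐ[unitMeasure] u ∧
      (∀ t, HasDerivAt p (p' t) t) ∧ ∀ t, HasDerivAt p' (-c • gradient V (p t)) t := by
  obtain ⟨p, hpc, hpa, hpu⟩ := exists_antiperiodic_extension (continuous_antiPrimitive_Lp u)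
    (antiPrimitive_one u)
  set w : ℝ → EuclideanSpace ℝ (Fin n) := fun t => gradient V (p t) with hw
  have hwc : Continuous w := (continuous_gradient hV).comp hpc
  have hwa : Function.Antiperiodic w 1 := fun t => by
    simp only [hw, hpa t, gradient_neg hV V1]
  have hae : ∀ᵐ t ∂unitMeasure, t ∈ Icc (0 : ℝ) 1 := by
    filter_upwards [ae_restrict_mem measurableSet_Ioc] with t ht
    exact Ioc_subset_Icc_self ht
  have hww : antiPrimitive (fun t => gradient V (antiPrimitive u t)) = antiPrimitive w := by
    refine antiPrimitive_congr_ae ?_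
    filter_upwards [hae] with t ht
    simp only [hw, hpu ht]
  have hWd := hasDerivAt_linePrimitive hwc
  have hWa := antiperiodic_linePrimitive hwc hwa
  have hWc : Continuous (linePrimitive w) :=
    continuous_iff_continuousAt.2 fun t => (hWd t).continuousAt
  have hline : ∀ f : ℝ → EuclideanSpace ℝ (Fin n),
      EqOn (antiPrimitive f) (linePrimitive f) (Icc 0 1) := fun f t ht => antiPrimitive_eq f ht
  have huW : u =ᵐ[unitMeasure] fun t => -c • linePrimitive w t := by
    filter_upwards [hu, hae] with t h1 h2
    rw [h1, hww, hline w h2]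
  -- On the unit interval this is the critical point equation; both sides are antiperiodic, so it
  -- holds on the line and gives the regularity of `p`.
  have hpW : p = fun t => -c • linePrimitive (linePrimitive w) t := by
    refine hpa.eq_of_eqOn_Icc ?_ fun t ht => ?_
    · intro t
      simp only [antiperiodic_linePrimitive hWc hWa t, smul_neg]
    · rw [hpu ht, antiPrimitive_congr_ae huW, antiPrimitive_smul, hline _ ht]
  refine ⟨p, fun t => -c • linePrimitive w t, hpa, hpu, huW.symm, fun t => ?_, fun t => ?_⟩
  · rw [hpW]
    exact (hasDerivAt_linePrimitive hWc t).const_smul (-c)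
  · exact (hWd t).const_smul (-c)

theorem exists_const_energy (hV : ContDiff ℝ 2 V) {x x' : ℝ → EuclideanSpace ℝ (Fin n)}
    (hx : ∀ t, HasDerivAt x (x' t) t) (hx' : ∀ t, HasDerivAt x' (-gradient V (x t)) t) :
    ∃ e, ∀ t, (1 / 2 : ℝ) * ‖x' t‖ ^ 2 + V (x t) = e := by
  have hd : ∀ t, HasDerivAt (fun t => (1 / 2 : ℝ) * ‖x' t‖ ^ 2 + V (x t)) 0 t := by
    intro t
    have h1 : HasFDerivAt V (fderiv ℝ V (x t)) (x t) :=
      ((hV.differentiable (by norm_num)) _).hasFDerivAt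
    refine (((hx' t).norm_sq.const_mul (1 / 2 : ℝ)).add
      (h1.comp_hasDerivAt t (hx t))).congr_deriv ?_
    rw [← inner_gradient, inner_neg_right, real_inner_comm]
    ring
  exact ⟨_, fun t => is_const_of_deriv_eq_zero (fun t => (hd t).differentiableAt)
    (fun t => (hd t).deriv) t 0⟩

theorem integral_norm_sq_Lp_two {E : Type*} [NormedAddCommGroup E] [InnerProductSpace ℝ E]
    (u : Lp E 2 unitMeasure) : ∫ t, ‖u t‖ ^ 2 ∂unitMeasure = ‖u‖ ^ 2 := by
  rw [← real_inner_self_eq_norm_sq, L2.inner_def]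
  simp only [real_inner_self_eq_norm_sq]

theorem exists_periodic_solution_of_critical (hV : ContDiff ℝ 2 V) (V1 : ∀ q, V (-q) = V q)
    {h : ℝ} {u : Lp (EuclideanSpace ℝ (Fin n)) 2 unitMeasure} (hP : 0 < potentialGap V h u)
    (hu : virialMean V u ≠ V 0)
    (hEL : ∀ v : Lp (EuclideanSpace ℝ (Fin n)) 2 unitMeasure,
      2 * potentialGap V h u * inner ℝ u v =
        ‖u‖ ^ 2 * ∫ t, fderiv ℝ V (antiPrimitive u t) (antiPrimitive v t) ∂unitMeasure) :
    ∃ q : ℝ → EuclideanSpace ℝ (Fin n), IsSolutionWithEnergy V h q ∧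
      (∃ T : ℝ, 0 < T ∧ Function.Periodic q T) ∧ ¬ ∃ c, ∀ t, q t = c := by
  have hu0 : 0 < ‖u‖ := norm_pos_iff.2 fun h0 => hu (by rw [h0, virialMean_zero])
  set c := ‖u‖ ^ 2 / (2 * potentialGap V h u) with hc
  have hc0 : 0 < c := by positivity
  obtain ⟨p, p', hpa, hpu, hp'u, hp, hp'⟩ := exists_antiperiodic_solution hV V1
    (eq_neg_smul_antiPrimitive_gradient hV hP hEL)
  simp only [← hc] at hp'
  set ω := Real.sqrt c⁻¹ with hω
  have hω2 : ω ^ 2 = c⁻¹ := Real.sq_sqrt (inv_pos.2 hc0).le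
  have hω0 : 0 < ω := Real.sqrt_pos.2 (inv_pos.2 hc0)
  have hlin : ∀ t, HasDerivAt (fun t : ℝ => ω * t) ω t := fun t => by
    simpa using (hasDerivAt_id t).const_mul ω
  have hx : ∀ t, HasDerivAt (fun t => p (ω * t)) (ω • p' (ω * t)) t := fun t =>
    (hp (ω * t)).scomp t (hlin t)
  have hx' : ∀ t, HasDerivAt (fun t => ω • p' (ω * t)) (-gradient V (p (ω * t))) t := by
    intro t
    refine (((hp' (ω * t)).scomp t (hlin t)).const_smul ω).congr_deriv ?_
    rw [smul_smul, smul_smul, ← sq, hω2, ← neg_one_smul ℝ (gradient V _)]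
    congr 1
    field_simp
  have hxc : Continuous fun t => p (ω * t) :=
    continuous_iff_continuousAt.2 fun t => (hx t).continuousAt
  have hpc : Continuous p := continuous_iff_continuousAt.2 fun t => (hp t).continuousAt
  have hp'c : Continuous p' := continuous_iff_continuousAt.2 fun t => (hp' t).continuousAt
  have hVp : Continuous fun t => V (p t) := hV.continuous.comp hpc
  obtain ⟨e, he⟩ := exists_const_energy hV hx hx'
  have hae : ∀ᵐ t ∂unitMeasure, p t = antiPrimitive u t := by
    filter_upwards [ae_restrict_mem measurableSet_Ioc] with t ht
    exact hpu (Ioc_subset_Icc_self ht)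
  have heh : e = h := by
    have h1 : ∀ t, (1 / 2 * ω ^ 2) * ‖p' t‖ ^ 2 + V (p t) = e := by
      intro t
      have := he (t / ω)
      rw [mul_div_cancel₀ _ hω0.ne', norm_smul, Real.norm_of_nonneg hω0.le] at this
      linarith
    have h2 : ∫ t, ((1 / 2 * ω ^ 2) * ‖p' t‖ ^ 2 + V (p t)) ∂unitMeasure = e := by
      simp only [h1]
      simp
    have hKc : Continuous fun t => 1 / 2 * ω ^ 2 * ‖p' t‖ ^ 2 := by fun_prop
    rw [MeasureTheory.integral_add (integrable_unitMeasure_of_continuous hKc)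
      (integrable_unitMeasure_of_continuous hVp),
      MeasureTheory.integral_const_mul] at h2
    have h3 : ∫ t, ‖p' t‖ ^ 2 ∂unitMeasure = ‖u‖ ^ 2 := by
      rw [← integral_norm_sq_Lp_two]
      refine integral_congr_ae ?_
      filter_upwards [hp'u] with t ht
      rw [ht]
    have h4 : ∫ t, V (p t) ∂unitMeasure = h - potentialGap V h u := by
      rw [potentialGap_eq hV, sub_sub_cancel]
      refine integral_congr_ae ?_
      filter_upwards [hae] with t ht
      rw [ht]
    -- The time scale makes the mean kinetic energy equal to the mean of `h - V`, so the conserved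
    -- energy is `h`.
    have h5 : 1 / 2 * ω ^ 2 * ‖u‖ ^ 2 = potentialGap V h u := by
      rw [hω2, hc]
      field_simp
    rw [h3, h4, h5] at h2
    linarith
  have hderiv : deriv (fun t => p (ω * t)) = fun t => ω • p' (ω * t) :=
    funext fun t => (hx t).deriv
  refine ⟨fun t => p (ω * t), ⟨?_, fun t => ?_, fun t => ?_⟩, ⟨ω⁻¹ * (2 * 1), by positivity, ?_⟩,
    ?_⟩
  · exact contDiff_two_of_hasDerivAt hx hx' ((continuous_gradient hV).comp hxc).neg
  · rw [hderiv, (hx' t).deriv, neg_add_cancel]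
  · rw [hderiv, ← heh]
    exact he t
  · exact hpa.periodic_two_mul.const_mul ω
  · rintro ⟨k, hk⟩
    have hpk : ∀ t, p t = k := fun t => by
      have : p (ω * (t / ω)) = k := hk (t / ω)
      rwa [mul_div_cancel₀ _ hω0.ne'] at this
    -- A constant antiperiodic path is zero, and then the virial mean would be `V 0`.
    have hk0 : k = 0 := by
      have := hpa 0
      rw [hpk, hpk] at this
      rw [eq_neg_iff_add_eq_zero, ← two_smul ℝ] at this
      simpa using this
    refine hu ?_
    have h1 : ∀ᵐ t ∂unitMeasure, virialEnergy V (antiPrimitive u t) = V 0 := by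
      filter_upwards [hae] with t ht
      rw [← ht, hpk, hk0, virialEnergy_zero]
    rw [virialMean, integral_congr_ae h1]
    simp

end Solution

theorem theorem1p4 (n : ℕ) (V : EuclideanSpace ℝ (Fin n) → ℝ) (hV : ContDiff ℝ 2 V)
    (h : ℝ) (A : EReal) (μ₁ μ₂ : ℝ) (hμ₁ : 0 < μ₁) (hμ₂ : 0 ≤ μ₂)
    (V1 : ∀ q, V (-q) = V q)
    (V2 : ∀ q, q ≠ 0 → 0 < fderiv ℝ V q q)
    (V3 : ∀ q, q ≠ 0 → 3 * fderiv ℝ V q q + fderiv ℝ (fderiv ℝ V) q q q ≠ 0)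
    (V4 : ∀ q, μ₁ * V q - μ₂ ≤ fderiv ℝ V q q)
    (V5 : limsup (fun q => ((virialEnergy V q : ℝ) : EReal))
      (Bornology.cobounded (EuclideanSpace ℝ (Fin n))) = A)
    (V6 : μ₂ / μ₁ < h ∧ (h : EReal) < A) :
    ∃ q : ℝ → EuclideanSpace ℝ (Fin n), IsSolutionWithEnergy V h q ∧
      (∃ T : ℝ, 0 < T ∧ Function.Periodic q T) ∧ ¬ ∃ c, ∀ t, q t = c := by
  obtain ⟨hμh, hhA⟩ := V6
  have hμ : μ₂ < h * μ₁ := (div_lt_iff₀ hμ₁).1 hμh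
  -- (4) at the origin reads `μ₁ V(0) ≤ μ₂`.
  have h0 : V 0 < h := by
    have := V4 0
    rw [map_zero] at this
    nlinarith
  obtain ⟨q₀, hq₀⟩ := (frequently_lt_of_lt_limsup (by isBoundedDefault)
    (hhA.trans_eq V5.symm)).exists
  obtain ⟨u, hu, hmin⟩ := exists_minimizer hV hμ₁ V4 hμh
    (exists_virialMean_eq hV h0.le (EReal.coe_lt_coe_iff.1 hq₀))
  have hP : 0 < potentialGap V h u :=
    (div_pos (by linarith) (by linarith)).trans_le (potentialGap_lower_bound hV hμ₁ V4 hu)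
  exact exists_periodic_solution_of_critical hV V1 hP (by rw [hu]; exact h0.ne')
    (euler_lagrange hV V2 V3 h0 hu hmin)
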